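/- A hyperbolic uniform disk graph (HUDG) is a finite graph $G$ for which there is a radius $r>0$ (which may depend on $G$) such that $G$ is the intersection graph of closed disks of radius $r$ in the hyperbolic plane. The strong product $H \boxtimes P$ has vertex set $V(H)\times V(P)$, and two distinct vertices are adjacent if and only if in each coordinate they are equal or adjacent. The row-treewidth of a finite graph $G$ is the minimum treewidth of a finite graph $H$ such that $G$ is isomorphic to a subgraph of $H \boxtimes P$ for some path $P$. A class of graphs has product structure if there is a constant $c$ such that every graph in the class has row-treewidth at most $c$. Theorem. Hyperbolic uniform disk graphs with constant clique number do not have product structure. More precisely, the class of all hyperbolic uniform disk graphs with clique number at most $5$ does not have product structure: for every $c$ there is a hyperbolic uniform disk graph $G$ with clique number at most $5$ that is not a subgraph of $H \boxtimes P$ for any graph $H$ of treewidth at most $c$ and any path $P$. -/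

import Mathlib

namespace RowTw

/-- The strong product `G ⊠ H`. -/
def strongProduct {V W : Type*} (G : SimpleGraph V) (H : SimpleGraph W) :
    SimpleGraph (V × W) where
  Adj u v :=
    (u.1 = v.1 ∧ H.Adj u.2 v.2) ∨ (u.2 = v.2 ∧ G.Adj u.1 v.1) ∨ (G.Adj u.1 v.1 ∧ H.Adj u.2 v.2)
  symm := ⟨by
    rintro u v (⟨h, h'⟩ | ⟨h, h'⟩ | ⟨h, h'⟩)
    · exact Or.inl ⟨h.symm, h'.symm⟩
    · exact Or.inr (Or.inl ⟨h.symm, h'.symm⟩)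
    · exact Or.inr (Or.inr ⟨h.symm, h'.symm⟩)⟩
  loopless := ⟨by
    rintro u (⟨_, h⟩ | ⟨_, h⟩ | ⟨h, _⟩)
    · exact H.loopless.irrefl _ h
    · exact G.loopless.irrefl _ h
    · exact G.loopless.irrefl _ h⟩

/-- A tree decomposition of `G` over a finite tree with node set `Fin t`. -/
structure TreeDecomposition {V : Type*} (G : SimpleGraph V) (t : ℕ) where
  /-- the decomposition tree -/
  tree : SimpleGraph (Fin t)
  isTree : tree.IsTree
  /-- the bag of each node of the tree -/
  bag : Fin t → Finset V
  vertex_mem : ∀ v : V, ∃ i, v ∈ bag i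
  edge_mem : ∀ u v : V, G.Adj u v → ∃ i, u ∈ bag i ∧ v ∈ bag i
  connected : ∀ v : V, (tree.induce {i | v ∈ bag i}).Connected

/-- The treewidth of a finite graph: the least `k` such that `G` has a tree decomposition all of
whose bags have at most `k + 1` vertices. -/
noncomputable def treewidth {V : Type*} [Finite V] (G : SimpleGraph V) : ℕ :=
  sInf {k | ∃ (t : ℕ) (D : TreeDecomposition G t), ∀ i, (D.bag i).card ≤ k + 1}

/-- The row-treewidth of a finite graph: the least treewidth of a finite graph `H` such that `G` is
(isomorphic to) a subgraph of `H ⊠ P` for some path `P`. -/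
noncomputable def rowTreewidth {V : Type*} [Finite V] (G : SimpleGraph V) : ℕ :=
  sInf {k | ∃ (m l : ℕ) (H : SimpleGraph (Fin m)),
    treewidth H = k ∧ G.IsContained (strongProduct H (SimpleGraph.pathGraph l))}

/-- A class of finite graphs, given by its members on the vertex sets `Fin n`. -/
abbrev GraphClass : Type := ∀ n : ℕ, Set (SimpleGraph (Fin n))

/-- A graph class has product structure if its members have uniformly bounded row-treewidth. -/
def HasProductStructure (𝒢 : GraphClass) : Prop :=
  ∃ c : ℕ, ∀ n : ℕ, ∀ G ∈ 𝒢 n, rowTreewidth G ≤ c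

/-- `G` is a hyperbolic uniform disk graph: the intersection graph of closed disks of some common
radius `r > 0` in the hyperbolic plane (`UpperHalfPlane` with its hyperbolic distance). -/
def IsHUDG {V : Type*} (G : SimpleGraph V) : Prop :=
  ∃ r : ℝ, 0 < r ∧ ∃ p : V → UpperHalfPlane, ∀ u v : V,
    G.Adj u v ↔ u ≠ v ∧ (Metric.closedBall (p u) r ∩ Metric.closedBall (p v) r).Nonempty

/-- The class of all hyperbolic uniform disk graphs with clique number at most `ω`. -/
def hudgClass (ω : ℕ) : GraphClass :=
  fun _ => {G | IsHUDG G ∧ G.cliqueNum ≤ ω}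

end RowTw

/-! Take an apex and `L` levels, level `i` being a horizontal row of `N_i = 32 ^ 3 ^ i` evenly
spaced points over the unit interval, at height proportional to `1 / N_i`. With a large common
radius, points of levels `i` and `j` are adjacent essentially when their horizontal distance is at
most `1 / √(N_i N_j)`.

Row-treewidth is large: each level contains a spanning path, any two levels are joined by an edge,
and the apex sees everything (`levelGraph_adj_none`). In `H ⊠ P` the neighbours of the apex occupy
at most three rows. Projected to `H`, the levels give pairwise meeting subtrees of a decomposition
tree, so by the Helly property one bag meets every level; hence `L` is at most three times the bag
size (`card_le_of_isContained_strongProduct`).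

Cliques are small: a clique has at most two points per level, and the fast growth of `N_i` keeps it
within two levels (`not_adj_of_lt_of_lt`); with the apex this makes five. -/

namespace RowTw

open SimpleGraph

/-! ### Subtrees of a tree and the Helly property -/

section Tree

variable {V : Type*} {T : SimpleGraph V}

/-- A subset of a connected graph's vertices inducing a preconnected subgraph contains the support
of some path between any two of its elements. -/
theorem exists_isPath_support_subset {S : Set V} (hS : (T.induce S).Preconnected) {s t : V}
    (hs : s ∈ S) (ht : t ∈ S) : ∃ p : T.Walk s t, p.IsPath ∧ ∀ v ∈ p.support, v ∈ S := by
  obtain ⟨p, hp⟩ := (hS ⟨s, hs⟩ ⟨t, ht⟩).exists_isPath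
  let e : T.induce S ↪g T := Embedding.induce S
  refine ⟨p.map e.toHom, (Walk.isPath_map_iff_of_injective e.injective).2 hp, fun v hv => ?_⟩
  obtain ⟨w, -, rfl⟩ := List.mem_map.1 ((Walk.support_map e.toHom p) ▸ hv)
  exact w.2

/-- In a tree, the path from a point of a connected set `S` to a point `r` passes through every
point of `S` closest to `r`. -/
theorem mem_support_of_forall_dist_le (hT : T.IsTree) {S : Set V}
    (hS : (T.induce S).Preconnected) {r g s : V} (hg : g ∈ S)
    (hmin : ∀ v ∈ S, T.dist g r ≤ T.dist v r) (hs : s ∈ S) (p : T.Walk s r) (hp : p.IsPath) :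
    g ∈ p.support := by
  classical
  obtain ⟨q, hq, hqS⟩ := exists_isPath_support_subset hS hs hg
  obtain ⟨w, hw, hwl⟩ := hT.connected.exists_path_of_dist g r
  -- A second common vertex of `q` and the geodesic `w` would lie in `S` and be closer to `r` than
  -- `g`.
  have key : (q.append w).IsPath := by
    rw [Walk.isPath_def, Walk.support_append, List.nodup_append]
    refine ⟨hq.support_nodup, hw.support_nodup.sublist (List.tail_sublist _), ?_⟩
    rintro a ha b hb rfl
    have haw : a ∈ w.support := List.mem_of_mem_tail hb
    have hag : a ≠ g := by
      rintro rfl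
      have := hw.support_nodup
      rw [← Walk.cons_tail_support] at this
      exact (List.nodup_cons.1 this).1 hb
    have h1 := hmin a (hqS a ha)
    have h2 : T.dist a r ≤ (w.dropUntil a haw).length := dist_le _
    have h3 := congrArg Walk.length (w.take_spec haw)
    rw [Walk.length_append] at h3
    have h4 : (w.takeUntil a haw).length ≠ 0 := fun h => hag (Walk.eq_of_length_eq_zero h).symm
    omega
  have := (hT.existsUnique_path s r).unique hp key
  rw [this, Walk.mem_support_append_iff]
  exact Or.inl q.end_mem_support

/-- The Helly property of subtrees of a tree. -/
theorem exists_mem_of_pairwise_inter [Finite V] (hT : T.IsTree) {ι : Type*} [Finite ι]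
    [Nonempty ι] (S : ι → Set V) (hS : ∀ i, (T.induce (S i)).Preconnected)
    (hinter : ∀ i j, (S i ∩ S j).Nonempty) : ∃ v, ∀ i, v ∈ S i := by
  classical
  obtain ⟨r⟩ := hT.connected.nonempty
  have hmin (i : ι) : ∃ g ∈ S i, ∀ v ∈ S i, T.dist g r ≤ T.dist v r := by
    obtain ⟨g, hg, h⟩ := Set.exists_min_image (S i) (fun v => T.dist v r) (Set.toFinite _)
      ((hinter i i).mono Set.inter_subset_left)
    exact ⟨g, hg, h⟩
  choose g hg hmin using hmin
  -- Rooting at `r`, the common point is the top vertex `g i` of the subtree whose top is deepest.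
  obtain ⟨i, hi⟩ := Finite.exists_max (fun i => T.dist (g i) r)
  refine ⟨g i, fun j => ?_⟩
  obtain ⟨s, hsi, hsj⟩ := hinter i j
  obtain ⟨p, hp, -⟩ := hT.existsUnique_path s r
  have h1 := mem_support_of_forall_dist_le hT (hS i) (hg i) (hmin i) hsi p hp
  have h2 := mem_support_of_forall_dist_le hT (hS j) (hg j) (hmin j) hsj p hp
  -- The path from `s` to `r` meets both tops. If `g i` comes no later than `g j`, it lies between
  -- two points of `S j`; otherwise maximality of its depth forces `g i = g j`.
  rw [← p.take_spec h2, Walk.mem_support_append_iff] at h1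
  rcases h1 with h1 | h1
  · obtain ⟨q, hq, hqS⟩ := exists_isPath_support_subset (hS j) hsj (hg j)
    rw [(hT.existsUnique_path s (g j)).unique (hp.takeUntil h2) hq] at h1
    exact hqS _ h1
  · have hd := hp.dropUntil h2
    obtain ⟨w, hw, hwl⟩ := hT.connected.exists_path_of_dist (g j) r
    have hdw := (hT.existsUnique_path (g j) r).unique hd hw
    have h3 := congrArg Walk.length ((p.dropUntil _ h2).take_spec h1)
    have h7 := congrArg Walk.length hdw
    rw [Walk.length_append] at h3
    have h4 : T.dist (g i) r ≤ ((p.dropUntil _ h2).dropUntil _ h1).length := dist_le _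
    have h5 := hi j
    have h6 : ((p.dropUntil _ h2).takeUntil _ h1).length = 0 := by
      omega
    rw [← Walk.eq_of_length_eq_zero h6]
    exact hg j

/-- The union of a chain of connected sets, consecutive ones meeting, is connected. -/
theorem preconnected_induce_iUnion_of_chain {n : ℕ} (S : Fin n → Set V)
    (hS : ∀ i, (T.induce (S i)).Preconnected)
    (hinter : ∀ i (h : i + 1 < n), (S ⟨i, by omega⟩ ∩ S ⟨i + 1, h⟩).Nonempty) :
    (T.induce (⋃ i, S i)).Preconnected := by
  have hmono (i : Fin n) {a b : V} (ha : a ∈ S i) (hb : b ∈ S i) :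
      (T.induce (⋃ i, S i)).Reachable ⟨a, Set.mem_iUnion_of_mem i ha⟩
        ⟨b, Set.mem_iUnion_of_mem i hb⟩ :=
    (hS i ⟨a, ha⟩ ⟨b, hb⟩).map (induceHomOfLE T (Set.subset_iUnion S i)).toHom
  have main (d : ℕ) : ∀ (i : ℕ) (h : i + d < n) {a b : V} (ha : a ∈ S ⟨i, by omega⟩)
      (hb : b ∈ S ⟨i + d, h⟩), (T.induce (⋃ i, S i)).Reachable ⟨a, Set.mem_iUnion_of_mem _ ha⟩
        ⟨b, Set.mem_iUnion_of_mem _ hb⟩ := by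
    induction d with
    | zero => exact fun i h a b ha hb => hmono _ ha hb
    | succ d ih =>
      intro i h a b ha hb
      obtain ⟨c, hc, hc'⟩ := hinter (i + d) (by omega)
      exact (ih i (by omega) ha hc).trans (hmono _ hc' hb)
  rintro ⟨a, ha⟩ ⟨b, hb⟩
  obtain ⟨⟨i, hi⟩, ha'⟩ := Set.mem_iUnion.1 ha
  obtain ⟨⟨j, hj⟩, hb'⟩ := Set.mem_iUnion.1 hb
  rcases le_total i j with h | h
  · obtain ⟨d, rfl⟩ := Nat.exists_eq_add_of_le h
    exact main d i hj ha' hb'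
  · obtain ⟨d, rfl⟩ := Nat.exists_eq_add_of_le h
    exact (main d j hi hb' ha').symm

end Tree

/-! ### A lower bound for row-treewidth -/

section Treewidth

variable {V : Type*}

/-- The minimum in the definition of treewidth is attained. -/
theorem exists_treeDecomposition_card_le [Finite V] (G : SimpleGraph V) :
    ∃ (t : ℕ) (D : TreeDecomposition G t), ∀ i, (D.bag i).card ≤ treewidth G + 1 := by
  classical
  have := Fintype.ofFinite V
  -- A one-node tree whose bag is everything shows that the infimum is not the default `0` of the
  -- empty set.
  refine Nat.sInf_mem
    (s := {k | ∃ (t : ℕ) (D : TreeDecomposition G t), ∀ i, (D.bag i).card ≤ k + 1})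
    ⟨Fintype.card V, 1, ⟨⊥, IsTree.of_subsingleton, fun _ => Finset.univ, by simp, by simp, ?_⟩, ?_⟩
  · intro v
    have : Nonempty {i : Fin 1 | v ∈ (Finset.univ : Finset V)} := ⟨⟨0, by simp⟩⟩
    exact ⟨fun a b => by rw [Subsingleton.elim a b]⟩
  · intro i
    simp

/-- The minimum in the definition of row-treewidth is attained. -/
theorem exists_isContained_strongProduct [Finite V] (G : SimpleGraph V) :
    ∃ (m l : ℕ) (H : SimpleGraph (Fin m)), treewidth H = rowTreewidth G ∧
      G.IsContained (strongProduct H (pathGraph l)) := by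
  obtain ⟨m, ⟨e⟩⟩ := Finite.exists_equiv_fin V
  -- Nonempty because `G` embeds in the product of a copy of itself with a one-vertex path.
  refine Nat.sInf_mem (s := {k | ∃ (m l : ℕ) (H : SimpleGraph (Fin m)),
    treewidth H = k ∧ G.IsContained (strongProduct H (pathGraph l))})
    ⟨_, m, 1, G.map e.toEmbedding, rfl, ⟨⟨⟨fun v => (e v, 0), ?_⟩, ?_⟩⟩⟩
  · intro a b h
    exact Or.inr (Or.inl ⟨rfl, (G.map_adj_apply (f := e.toEmbedding)).2 h⟩)
  · intro a b h
    exact e.injective (Prod.ext_iff.1 h).1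

/-- If `G` contains a vertex adjacent to every vertex of `L` disjoint pairwise adjacent paths,
then `L` is at most `3` times the bag size of any graph `H` such that `G ⊆ H ⊠ P`. -/
theorem card_le_of_isContained_strongProduct {L m l t k : ℕ} {G : SimpleGraph V}
    {H : SimpleGraph (Fin m)} (hG : G.IsContained (strongProduct H (pathGraph l)))
    (D : TreeDecomposition H t) (hD : ∀ i, (D.bag i).card ≤ k)
    (a : V) (N : Fin L → ℕ) (hN : ∀ i, 0 < N i) (q : ∀ i, Fin (N i) → V)
    (hq : ∀ i j u v, q i u = q j v → i = j) (ha : ∀ i u, G.Adj a (q i u))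
    (hpath : ∀ i u (h : u + 1 < N i), G.Adj (q i ⟨u, by omega⟩) (q i ⟨u + 1, h⟩))
    (hcross : ∀ i j, i < j → ∃ u v, G.Adj (q i u) (q j v)) : L ≤ 3 * k := by
  classical
  obtain ⟨f⟩ := hG
  rcases Nat.eq_zero_or_pos L with rfl | hL
  · simp
  have : Nonempty (Fin L) := ⟨⟨0, hL⟩⟩
  have hcommon {u v : V} (h : G.Adj u v) : ∃ i, (f u).1 ∈ D.bag i ∧ (f v).1 ∈ D.bag i := by
    rcases f.toHom.map_adj h with ⟨h, -⟩ | ⟨-, h⟩ | ⟨h, -⟩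
    · obtain ⟨i, hi⟩ := D.vertex_mem (f u).1
      exact ⟨i, hi, by rw [← show (f u).1 = (f v).1 from h]; exact hi⟩
    · exact D.edge_mem _ _ h
    · exact D.edge_mem _ _ h
  let S (i : Fin L) : Set (Fin t) := ⋃ u, {b | (f (q i u)).1 ∈ D.bag b}
  have hS (i : Fin L) : (D.tree.induce (S i)).Preconnected :=
    preconnected_induce_iUnion_of_chain _ (fun u => (D.connected _).preconnected)
      (fun u h => hcommon (hpath i u h))
  have hlt {i j : Fin L} (h : i < j) : (S i ∩ S j).Nonempty := by
    obtain ⟨u, v, huv⟩ := hcross i j h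
    obtain ⟨b, hu, hv⟩ := hcommon huv
    exact ⟨b, Set.mem_iUnion_of_mem u hu, Set.mem_iUnion_of_mem v hv⟩
  obtain ⟨b, hb⟩ := exists_mem_of_pairwise_inter D.isTree S hS (fun i j => by
    rcases lt_trichotomy i j with h | rfl | h
    · exact hlt h
    · obtain ⟨b, hb⟩ := D.vertex_mem (f (q i ⟨0, hN i⟩)).1
      exact ⟨b, Set.mem_iUnion_of_mem _ hb, Set.mem_iUnion_of_mem _ hb⟩
    · rw [Set.inter_comm]
      exact hlt h)
  have hb' (i : Fin L) : ∃ u, (f (q i u)).1 ∈ D.bag b := by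
    simpa only [S, Set.mem_iUnion, Set.mem_ofPred_eq] using hb i
  choose u hu using hb'
  -- Neighbours of `a` lie within one row of it; truncated subtraction only shortens the interval
  -- when `a` is in row `0`.
  have hrow (i : Fin L) :
      ((f (q i (u i))).2 : ℕ) ∈ Finset.Icc (((f a).2 : ℕ) - 1) ((f a).2 + 1) := by
    rw [Finset.mem_Icc]
    rcases f.toHom.map_adj (ha i (u i)) with ⟨-, h⟩ | ⟨h, -⟩ | ⟨-, h⟩
    · have h := pathGraph_adj.1 h
      simp only [Copy.toHom_apply] at h
      omega
    · simp only [Copy.toHom_apply] at h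
      rw [h]
      omega
    · have h := pathGraph_adj.1 h
      simp only [Copy.toHom_apply] at h
      omega
  -- The chosen vertices, one per path, occupy distinct cells of one bag times three rows.
  have hcard := Finset.card_le_card_of_injOn (s := Finset.univ)
    (t := D.bag b ×ˢ Finset.Icc (((f a).2 : ℕ) - 1) ((f a).2 + 1))
    (fun i => ((f (q i (u i))).1, ((f (q i (u i))).2 : ℕ)))
    (fun i _ => Finset.mem_coe.2 (Finset.mem_product.2 ⟨hu i, hrow i⟩)) (by
      intro i _ j _ h
      rw [Prod.mk.injEq] at h
      exact hq _ _ _ _ (f.injective (Prod.ext h.1 (Fin.ext h.2))))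
  rw [Finset.card_univ, Fintype.card_fin, Finset.card_product, Nat.card_Icc] at hcard
  calc L ≤ _ := hcard
    _ ≤ k * 3 := Nat.mul_le_mul (hD b) (by omega)
    _ = 3 * k := mul_comm _ _

end Treewidth

end RowTw

/-! ### Intersecting discs in the upper half-plane -/

namespace RowTw

open UpperHalfPlane

theorem cosh_dist_coords (z w : ℍ) : Real.cosh (dist z w) =
    1 + ((z.re - w.re) ^ 2 + (z.im - w.im) ^ 2) / (2 * z.im * w.im) := by
  rw [cosh_dist, Complex.dist_eq, Complex.sq_norm, Complex.normSq_apply]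
  simp [sq]

/-- The hyperbolic midpoint of two points of the upper half-plane. -/
noncomputable def midpoint (z w : ℍ) : ℍ :=
  ⟨⟨(z.re * w.im + w.re * z.im) / (z.im + w.im),
    √(2 + 2 * Real.cosh (dist z w)) * (z.im * w.im) / (z.im + w.im)⟩, by
    have := Real.cosh_pos (dist z w)
    have := z.im_pos
    have := w.im_pos
    positivity⟩

theorem dist_midpoint_left (z w : ℍ) : dist z (midpoint z w) = dist z w / 2 := by
  have hz := z.im_pos
  have hw := w.im_pos
  have hc := Real.cosh_pos (dist z w)
  -- Half-angle formula; it turns the height of the midpoint into a rational expression in `cosh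
  -- (dist z w / 2)`.
  have hs : √(2 + 2 * Real.cosh (dist z w)) = 2 * Real.cosh (dist z w / 2) := by
    rw [Real.sqrt_eq_iff_mul_self_eq_of_pos (by positivity)]
    have := Real.cosh_sq (dist z w / 2)
    have h2 := Real.cosh_two_mul (dist z w / 2)
    rw [mul_div_cancel₀ _ two_ne_zero] at h2
    nlinarith
  have hC := Real.cosh_pos (dist z w / 2)
  have hC2 : 4 * Real.cosh (dist z w / 2) ^ 2 =
      4 + ((z.re - w.re) ^ 2 + (z.im - w.im) ^ 2) / (z.im * w.im) := by
    have h2 := Real.cosh_two_mul (dist z w / 2)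
    have := Real.cosh_sq (dist z w / 2)
    rw [mul_div_cancel₀ _ two_ne_zero, cosh_dist_coords] at h2
    have h3 : ((z.re - w.re) ^ 2 + (z.im - w.im) ^ 2) / (z.im * w.im) =
      2 * (((z.re - w.re) ^ 2 + (z.im - w.im) ^ 2) / (2 * z.im * w.im)) := by
      field_simp
    rw [h3]
    linarith
  have key : Real.cosh (dist z (midpoint z w)) = Real.cosh (dist z w / 2) := by
    have hre : (midpoint z w).re = (z.re * w.im + w.re * z.im) / (z.im + w.im) := rfl
    have him : (midpoint z w).im =
      2 * Real.cosh (dist z w / 2) * (z.im * w.im) / (z.im + w.im) := by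
      rw [← hs]; rfl
    rw [cosh_dist_coords, hre, him]
    generalize Real.cosh (dist z w / 2) = C at *
    field_simp at hC2 ⊢
    linear_combination (-z.im ^ 2) * hC2
  have := Real.cosh_le_cosh.1 key.le
  have h' := Real.cosh_le_cosh.1 key.ge
  rw [abs_of_nonneg dist_nonneg, abs_of_nonneg (by positivity)] at this h'
  exact le_antisymm this h'

theorem midpoint_comm (z w : ℍ) : midpoint z w = midpoint w z := by
  apply UpperHalfPlane.ext
  simp only [midpoint, dist_comm z w, mul_comm z.im, add_comm z.im, add_comm (z.re * _)]

theorem closedBall_inter_nonempty_iff (z w : ℍ) (r : ℝ) :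
    (Metric.closedBall z r ∩ Metric.closedBall w r).Nonempty ↔ dist z w ≤ 2 * r := by
  constructor
  · rintro ⟨x, hz, hw⟩
    rw [Metric.mem_closedBall] at hz hw
    linarith [dist_triangle_left z w x]
  · intro h
    refine ⟨midpoint z w, ?_, ?_⟩ <;> rw [Metric.mem_closedBall, dist_comm]
    · rw [dist_midpoint_left]
      linarith
    · rw [midpoint_comm, dist_midpoint_left, dist_comm]
      linarith

/-- Closed discs of radius `arsinh (R / 2)` intersect iff their centres satisfy an algebraic
inequality. -/
theorem closedBall_arsinh_inter_nonempty_iff (z w : ℍ) {R : ℝ} (hR : 0 < R) :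
    (Metric.closedBall z (Real.arsinh (R / 2)) ∩
      Metric.closedBall w (Real.arsinh (R / 2))).Nonempty ↔
    (z.re - w.re) ^ 2 + (z.im - w.im) ^ 2 ≤ R ^ 2 * (z.im * w.im) := by
  have hr : 0 < Real.arsinh (R / 2) := Real.arsinh_pos_iff.2 (by positivity)
  have hz := z.im_pos
  have hw := w.im_pos
  have h1 : Real.cosh (2 * Real.arsinh (R / 2)) = 1 + R ^ 2 / 2 := by
    rw [Real.cosh_two_mul, Real.cosh_sq, Real.sinh_arsinh]
    ring
  rw [closedBall_inter_nonempty_iff, ← abs_of_nonneg (dist_nonneg (x := z) (y := w)),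
    ← abs_of_pos (show 0 < 2 * Real.arsinh (R / 2) by positivity), ← Real.cosh_le_cosh,
    h1, cosh_dist_coords, add_le_add_iff_left, div_le_div_iff₀ (by positivity) (by positivity)]
  constructor <;> intro h <;> nlinarith

end RowTw

/-! ### Level sizes and horizontal positions -/

namespace RowTw

open SimpleGraph

/-- The number of vertices of each level of the construction. -/
def levelSize (m : ℕ) : ℕ := 32 ^ 3 ^ m

theorem levelSize_pos (m : ℕ) : 0 < levelSize m := by
  unfold levelSize
  positivity

theorem levelSize_mono {i j : ℕ} (h : i ≤ j) : levelSize i ≤ levelSize j :=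
  Nat.pow_le_pow_right (by norm_num) (Nat.pow_le_pow_right (by norm_num) h)

theorem sq_levelSize_lt {i j : ℕ} (h : i < j) : 16 * levelSize i ^ 2 < levelSize j := by
  have h1 : 3 ^ (i + 1) ≤ 3 ^ j := Nat.pow_le_pow_right (by norm_num) h
  have h2 : 0 < 3 ^ i := by positivity
  have h3 : 32 ^ (3 ^ i * 2 + 1) ≤ levelSize j := by
    refine Nat.pow_le_pow_right (by norm_num) ?_
    rw [pow_succ] at h1
    omega
  have h4 := levelSize_pos i
  rw [pow_succ, pow_mul] at h3
  change levelSize i ^ 2 * 32 ≤ _ at h3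
  nlinarith

/-- The even ratio keeps positions of different levels apart: over the common denominator `2 *
levelSize j`, the numerators are even for level `i` and odd for level `j`. -/
theorem exists_levelSize_eq {i j : ℕ} (h : i < j) :
    ∃ d, levelSize j = levelSize i * (2 * d) := by
  have h1 : 3 ^ i < 3 ^ j := Nat.pow_lt_pow_right (by norm_num) h
  refine ⟨16 * 32 ^ (3 ^ j - 3 ^ i - 1), ?_⟩
  unfold levelSize
  rw [show 3 ^ j = 3 ^ i + 1 + (3 ^ j - 3 ^ i - 1) by omega, pow_add, pow_add]
  rw [show 3 ^ i + 1 + (3 ^ j - 3 ^ i - 1) - 3 ^ i - 1 = 3 ^ j - 3 ^ i - 1 by omega]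
  ring

/-- The position of the `n`-th vertex of level `m`. -/
noncomputable def position (m n : ℕ) : ℝ := (2 * n + 1) / (2 * levelSize m)

theorem position_pos (m n : ℕ) : 0 < position m n := by
  have := levelSize_pos m
  unfold position
  positivity

theorem position_le_one {m n : ℕ} (h : n < levelSize m) : position m n ≤ 1 := by
  have h0 : (0 : ℝ) < levelSize m := by exact_mod_cast levelSize_pos m
  have h1 : (n : ℝ) + 1 ≤ levelSize m := by exact_mod_cast h
  rw [position, div_le_one (by positivity)]
  linarith

theorem position_sub_sq (m n n' : ℕ) :
    (position m n - position m n') ^ 2 = ((n : ℝ) - n') ^ 2 / levelSize m ^ 2 := by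
  have h0 : (0 : ℝ) < levelSize m := by exact_mod_cast levelSize_pos m
  unfold position
  field_simp
  ring

/-- Vertices of different levels are horizontally separated. -/
theorem le_position_sub_sq {i k : ℕ} (h : i < k) (a b : ℕ) :
    1 / (4 * (levelSize k : ℝ) ^ 2) ≤ (position i a - position k b) ^ 2 := by
  obtain ⟨d, hd⟩ := exists_levelSize_eq h
  have hk : (0 : ℝ) < levelSize k := by exact_mod_cast levelSize_pos k
  have hi : (0 : ℝ) < levelSize i := by exact_mod_cast levelSize_pos i
  have hd' : (levelSize k : ℝ) = levelSize i * (2 * d) := by exact_mod_cast hd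
  have hne : (2 * a + 1) * (2 * d) - (2 * b + 1) ≠ (0 : ℤ) := by
    have : (2 * a + 1) * (2 * d) - (2 * b + 1) = 2 * ((2 * a + 1) * d - b) - (1 : ℤ) := by ring
    omega
  have h1 : (1 : ℤ) ≤ ((2 * a + 1) * (2 * d) - (2 * b + 1)) ^ 2 :=
    Int.add_one_le_iff.2 (sq_pos_iff.2 hne)
  have h2 : (1 : ℝ) ≤ ((2 * a + 1) * (2 * d) - (2 * b + 1)) ^ 2 := by exact_mod_cast h1
  have hd0 : (0 : ℝ) < d := by
    by_contra h0
    have : (levelSize i : ℝ) * (2 * d) ≤ 0 := mul_nonpos_of_nonneg_of_nonpos hi.le (by linarith)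
    linarith
  have h3 : (position i a - position k b) ^ 2 =
      ((2 * a + 1) * (2 * d) - (2 * b + 1)) ^ 2 / (4 * (levelSize k : ℝ) ^ 2) := by
    unfold position
    rw [hd']
    field_simp
    ring
  rw [h3]
  gcongr

/-- The first vertex of level `i` lies within half a step of some vertex of each later level `j`. -/
theorem exists_position_sub_sq_eq {i j : ℕ} (h : i < j) :
    ∃ n < levelSize j, (position i 0 - position j n) ^ 2 = 1 / (4 * (levelSize j : ℝ) ^ 2) := by
  obtain ⟨d, hd⟩ := exists_levelSize_eq h
  have hi := levelSize_pos i
  have hj := levelSize_pos j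
  have hi' : (0 : ℝ) < levelSize i := by exact_mod_cast hi
  have hd' : (levelSize j : ℝ) = levelSize i * (2 * d) := by exact_mod_cast hd
  have hd0 : 0 < d := Nat.pos_of_ne_zero (by rintro rfl; omega)
  have hd0' : (0 : ℝ) < d := by exact_mod_cast hd0
  refine ⟨d, by nlinarith, ?_⟩
  unfold position
  rw [hd']
  push_cast
  field_simp
  ring

/-! ### The disc graph and its edges -/

/-- The vertices of the construction: an apex, and `L` levels. -/
abbrev Vertex (L : ℕ) : Type := Option (Σ i : Fin L, Fin (levelSize i))

/-- The parameter that determines the common radius of the discs. -/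
def scale (L : ℕ) : ℝ := 2 * levelSize L

theorem scale_pos (L : ℕ) : 0 < scale L := by
  have : (0 : ℝ) < levelSize L := by exact_mod_cast levelSize_pos L
  unfold scale
  positivity

theorem two_mul_levelSize_le_scale {L : ℕ} (i : Fin L) : 2 * (levelSize i : ℝ) ≤ scale L := by
  have : (levelSize i : ℝ) ≤ levelSize L := by exact_mod_cast levelSize_mono i.2.le
  unfold scale
  linarith

/-- The centres of the discs of the construction. -/
noncomputable def center (L : ℕ) : Vertex L → UpperHalfPlane
  | none => ⟨⟨0, 1⟩, one_pos⟩
  | some v => ⟨⟨position v.1 v.2, 1 / (levelSize v.1 * scale L)⟩, by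
      have := scale_pos L
      have : (0 : ℝ) < levelSize v.1 := by exact_mod_cast levelSize_pos v.1
      positivity⟩

/-- The intersection graph of closed discs of radius `r`. -/
def discGraph {V : Type*} (p : V → UpperHalfPlane) (r : ℝ) : SimpleGraph V where
  Adj u v := u ≠ v ∧ (Metric.closedBall (p u) r ∩ Metric.closedBall (p v) r).Nonempty
  symm := ⟨fun _ _ h => ⟨h.1.symm, by rw [Set.inter_comm]; exact h.2⟩⟩
  loopless := ⟨fun _ h => h.1 rfl⟩

/-- An apex together with `L` levels of vertices. -/
noncomputable def levelGraph (L : ℕ) : SimpleGraph (Vertex L) :=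
  discGraph (center L) (Real.arsinh (scale L / 2))

/-- Both squared coordinate differences are at most `1`, and the factor `2` in `scale` makes the
right-hand side at least `2`. -/
theorem levelGraph_adj_none (L : ℕ) (v : Σ i : Fin L, Fin (levelSize i)) :
    (levelGraph L).Adj none (some v) := by
  refine ⟨by simp, (closedBall_arsinh_inter_nonempty_iff _ _ (scale_pos L)).2 ?_⟩
  change (0 - position v.1 v.2) ^ 2 + (1 - 1 / (levelSize v.1 * scale L)) ^ 2 ≤
    scale L ^ 2 * (1 * (1 / (levelSize v.1 * scale L)))
  have h0 := scale_pos L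
  have hN : (1 : ℝ) ≤ levelSize v.1 := by exact_mod_cast levelSize_pos v.1
  have h1 := position_pos v.1 v.2
  have h2 := position_le_one v.2.2
  have h3 := two_mul_levelSize_le_scale v.1
  have h4 : 0 < 1 / (levelSize v.1 * scale L) := by positivity
  have h5 : 1 / (levelSize v.1 * scale L) ≤ 1 := by
    rw [div_le_one (by positivity)]
    nlinarith
  have h6 : scale L ^ 2 * (1 * (1 / (levelSize v.1 * scale L))) = scale L / levelSize v.1 := by
    field_simp
  have h7 : 2 ≤ scale L / levelSize v.1 := by
    rw [le_div_iff₀ (by positivity)]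
    exact h3
  rw [h6]
  nlinarith

/-- The heights carry a factor `1 / scale L`, which cancels on the right and leaves the vertical
term negligible. -/
theorem levelGraph_adj_some_iff {L : ℕ} (v w : Σ i : Fin L, Fin (levelSize i)) :
    (levelGraph L).Adj (some v) (some w) ↔ v ≠ w ∧
      (position v.1 v.2 - position w.1 w.2) ^ 2 +
        (1 / levelSize v.1 - 1 / levelSize w.1) ^ 2 / scale L ^ 2 ≤
          1 / (levelSize v.1 * (levelSize w.1 : ℝ)) := by
  have h0 := scale_pos L
  have hv : (0 : ℝ) < levelSize v.1 := by exact_mod_cast levelSize_pos v.1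
  have hw : (0 : ℝ) < levelSize w.1 := by exact_mod_cast levelSize_pos w.1
  refine and_congr (by simp) ?_
  rw [closedBall_arsinh_inter_nonempty_iff _ _ h0]
  change (position v.1 v.2 - position w.1 w.2) ^ 2 + (1 / (levelSize v.1 * scale L) -
      1 / (levelSize w.1 * scale L)) ^ 2 ≤
    scale L ^ 2 * (1 / (levelSize v.1 * scale L) * (1 / (levelSize w.1 * scale L))) ↔ _
  have h1 : (1 / (levelSize v.1 * scale L) - 1 / (levelSize w.1 * scale L)) ^ 2 =
      (1 / levelSize v.1 - 1 / levelSize w.1) ^ 2 / scale L ^ 2 := by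
    field_simp
  have h2 : scale L ^ 2 * (1 / (levelSize v.1 * scale L) * (1 / (levelSize w.1 * scale L))) =
      1 / (levelSize v.1 * (levelSize w.1 : ℝ)) := by
    field_simp
  rw [h1, h2]

theorem position_sub_sq_le_of_adj {L : ℕ} {v w : Σ i : Fin L, Fin (levelSize i)}
    (h : (levelGraph L).Adj (some v) (some w)) :
    (position v.1 v.2 - position w.1 w.2) ^ 2 ≤
      1 / (levelSize v.1 * (levelSize w.1 : ℝ)) := by
  have h1 := ((levelGraph_adj_some_iff v w).1 h).2
  have h2 : 0 ≤ (1 / (levelSize v.1 : ℝ) - 1 / levelSize w.1) ^ 2 / scale L ^ 2 := by positivity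
  linarith

theorem levelGraph_adj_succ {L : ℕ} (i : Fin L) (n : ℕ) (h : n + 1 < levelSize i) :
    (levelGraph L).Adj (some ⟨i, n, by omega⟩) (some ⟨i, n + 1, h⟩) := by
  rw [levelGraph_adj_some_iff]
  refine ⟨by simp, ?_⟩
  simp only [position_sub_sq]
  push_cast
  simp [sq]

/-- The horizontal and the vertical term are each at most `1 / (4 N_j ^ 2)`, with sum below `1 /
(N_i N_j)`. -/
theorem exists_levelGraph_adj {L : ℕ} {i j : Fin L} (h : i < j) :
    ∃ u v, (levelGraph L).Adj (some ⟨i, u⟩) (some ⟨j, v⟩) := by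
  obtain ⟨n, hn, hpos⟩ := exists_position_sub_sq_eq (Fin.lt_def.1 h)
  refine ⟨⟨0, levelSize_pos i⟩, ⟨n, hn⟩, (levelGraph_adj_some_iff _ _).2 ⟨?_, ?_⟩⟩
  · intro h'
    exact h.ne (congrArg Sigma.fst h')
  simp only [hpos]
  have hi : (1 : ℝ) ≤ levelSize i := by exact_mod_cast levelSize_pos i
  have hij : (levelSize i : ℝ) ≤ levelSize j := by exact_mod_cast levelSize_mono h.le
  have hj : (0 : ℝ) < levelSize j := by linarith
  have hs := two_mul_levelSize_le_scale j
  have h1 : (1 / (levelSize i : ℝ) - 1 / levelSize j) ^ 2 ≤ 1 := by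
    have ha : 1 / (levelSize i : ℝ) ≤ 1 := by rw [div_le_one (by linarith)]; exact hi
    have hb : 1 / (levelSize j : ℝ) ≤ 1 / levelSize i := one_div_le_one_div_of_le (by linarith) hij
    have hc : 0 < 1 / (levelSize j : ℝ) := by positivity
    nlinarith
  have h2 : (1 / (levelSize i : ℝ) - 1 / levelSize j) ^ 2 / scale L ^ 2 ≤
      1 / (4 * (levelSize j : ℝ) ^ 2) := by
    refine div_le_div₀ zero_le_one h1 (by positivity) ?_
    nlinarith
  have h3 : 1 / (2 * (levelSize j : ℝ) ^ 2) ≤ 1 / (levelSize i * (levelSize j : ℝ)) :=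
    one_div_le_one_div_of_le (by positivity) (by nlinarith)
  have h4 : 1 / (2 * (levelSize j : ℝ) ^ 2) =
      1 / (4 * (levelSize j : ℝ) ^ 2) + 1 / (4 * (levelSize j : ℝ) ^ 2) := by
    field_simp
    norm_num
  linarith

/-! ### Clique number -/

/-- No triangle meets three levels. -/
theorem not_adj_of_lt_of_lt {L : ℕ} {u v w : Σ i : Fin L, Fin (levelSize i)}
    (huv : u.1 < v.1) (hvw : v.1 < w.1) (h1 : (levelGraph L).Adj (some u) (some w))
    (h2 : (levelGraph L).Adj (some v) (some w)) : False := by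
  have hu : (1 : ℝ) ≤ levelSize u.1 := by exact_mod_cast levelSize_pos u.1
  have hv : (1 : ℝ) ≤ levelSize v.1 := by exact_mod_cast levelSize_pos v.1
  have hw : (1 : ℝ) ≤ levelSize w.1 := by exact_mod_cast levelSize_pos w.1
  have h3 := le_position_sub_sq (Fin.lt_def.1 huv) u.2 v.2
  have h4 : 16 * (levelSize v.1 : ℝ) ^ 2 < levelSize w.1 := by
    exact_mod_cast sq_levelSize_lt (Fin.lt_def.1 hvw)
  have h5 : 1 / (levelSize u.1 * (levelSize w.1 : ℝ)) ≤ 1 / levelSize w.1 :=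
    one_div_le_one_div_of_le (by positivity) (by nlinarith)
  have h6 : 1 / (levelSize v.1 * (levelSize w.1 : ℝ)) ≤ 1 / levelSize w.1 :=
    one_div_le_one_div_of_le (by positivity) (by nlinarith)
  have h7 : 1 / (levelSize w.1 : ℝ) < 1 / (16 * (levelSize v.1 : ℝ) ^ 2) :=
    one_div_lt_one_div_of_lt (by positivity) h4
  have h8 : 1 / (4 * (levelSize v.1 : ℝ) ^ 2) = 4 * (1 / (16 * (levelSize v.1 : ℝ) ^ 2)) := by
    field_simp
    norm_num
  have h9 := position_sub_sq_le_of_adj h1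
  have h10 := position_sub_sq_le_of_adj h2
  -- By `(x - y) ^ 2 ≤ 2 * x ^ 2 + 2 * y ^ 2`, the squared gap between `u` and `v` is at most `4 /
  -- N_w`, less than the `1 / (4 N_v ^ 2)` required by `h3`.
  nlinarith [sq_nonneg (position u.1 u.2 - position w.1 w.2 +
    (position v.1 v.2 - position w.1 w.2))]

theorem le_add_one_of_adj {L : ℕ} {v w : Σ i : Fin L, Fin (levelSize i)}
    (h : (levelGraph L).Adj (some v) (some w)) (hvw : v.1 = w.1) : (v.2 : ℕ) ≤ w.2 + 1 := by
  obtain ⟨i, n⟩ := v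
  obtain ⟨j, n'⟩ := w
  obtain rfl : i = j := hvw
  have h1 := position_sub_sq_le_of_adj h
  have hi : (0 : ℝ) < levelSize i := by exact_mod_cast levelSize_pos i
  simp only [position_sub_sq] at h1
  rw [← sq, div_le_div_iff_of_pos_right (by positivity)] at h1
  have h2 := (abs_le.1 ((sq_le_one_iff_abs_le_one _).1 h1)).2
  have h3 : ((n : ℕ) : ℝ) ≤ (n' : ℕ) + 1 := by linarith
  exact_mod_cast h3

theorem card_image_fst_le {L : ℕ} {t : Finset (Σ i : Fin L, Fin (levelSize i))}
    (ht : ∀ v ∈ t, ∀ w ∈ t, v ≠ w → (levelGraph L).Adj (some v) (some w)) :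
    (t.image Sigma.fst).card ≤ 2 := by
  by_contra! h
  obtain ⟨a, ha, b, hb, c, hc, hab, hac, hbc⟩ := Finset.two_lt_card.1 h
  obtain ⟨u, hu, rfl⟩ := Finset.mem_image.1 ha
  obtain ⟨v, hv, rfl⟩ := Finset.mem_image.1 hb
  obtain ⟨w, hw, rfl⟩ := Finset.mem_image.1 hc
  have key {x y z : Σ i : Fin L, Fin (levelSize i)} (hx : x ∈ t) (hy : y ∈ t) (hz : z ∈ t)
      (hxy : x.1 < y.1) (hyz : y.1 < z.1) : False :=
    not_adj_of_lt_of_lt hxy hyz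
      (ht x hx z hz fun h => (hxy.trans hyz).ne (congrArg Sigma.fst h))
      (ht y hy z hz fun h => hyz.ne (congrArg Sigma.fst h))
  rcases hab.lt_or_gt with h1 | h1 <;> rcases hac.lt_or_gt with h2 | h2 <;>
    rcases hbc.lt_or_gt with h3 | h3
  · exact key hu hv hw h1 h3
  · exact key hu hw hv h2 h3
  · exact key hu hv hw h1 h3
  · exact key hw hu hv h2 h1
  · exact key hv hu hw h1 h2
  · exact key hv hu hw h1 h2
  · exact key hv hw hu h3 h2
  · exact key hw hv hu h3 h1

theorem card_filter_fst_le {L : ℕ} {t : Finset (Σ i : Fin L, Fin (levelSize i))}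
    (ht : ∀ v ∈ t, ∀ w ∈ t, v ≠ w → (levelGraph L).Adj (some v) (some w)) (i : Fin L) :
    (t.filter fun v => v.1 = i).card ≤ 2 := by
  by_contra! h
  obtain ⟨⟨_, a⟩, ha, ⟨_, b⟩, hb, ⟨_, c⟩, hc, hab, hac, hbc⟩ := Finset.two_lt_card.1 h
  obtain ⟨hat, rfl⟩ := Finset.mem_filter.1 ha
  obtain ⟨hbt, rfl⟩ := Finset.mem_filter.1 hb
  obtain ⟨hct, rfl⟩ := Finset.mem_filter.1 hc
  have h1 := le_add_one_of_adj (ht _ hat _ hbt hab) rfl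
  have h2 := le_add_one_of_adj (ht _ hat _ hct hac) rfl
  have h3 := le_add_one_of_adj (ht _ hbt _ hct hbc) rfl
  have h4 := le_add_one_of_adj (ht _ hbt _ hat hab.symm) rfl
  have h5 := le_add_one_of_adj (ht _ hct _ hat hac.symm) rfl
  have h6 := le_add_one_of_adj (ht _ hct _ hbt hbc.symm) rfl
  have n1 : (a : ℕ) ≠ b := fun h => hab (by rw [Fin.ext h])
  have n2 : (a : ℕ) ≠ c := fun h => hac (by rw [Fin.ext h])
  have n3 : (b : ℕ) ≠ c := fun h => hbc (by rw [Fin.ext h])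
  dsimp only at h1 h2 h3 h4 h5 h6
  omega

theorem levelGraph_cliqueFree (L : ℕ) : (levelGraph L).CliqueFree 6 := by
  classical
  intro s hs
  have ht : ∀ v ∈ s.eraseNone, ∀ w ∈ s.eraseNone, v ≠ w →
      (levelGraph L).Adj (some v) (some w) := fun v hv w hw hvw =>
    hs.isClique (Finset.mem_eraseNone.1 hv) (Finset.mem_eraseNone.1 hw)
      (fun h => hvw (Option.some_injective _ h))
  -- Two levels with two vertices each, plus the apex, give at most five.
  have h1 := Finset.card_le_mul_card_image s.eraseNone 2
    (f := Sigma.fst) (fun i _ => card_filter_fst_le ht i)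
  have h2 := card_image_fst_le ht
  have h3 := Finset.card_le_card (Finset.subset_insert none s)
  rw [← Finset.insertNone_eraseNone, Finset.card_insertNone, hs.card_eq] at h3
  omega

/-! ### Conclusion -/

theorem IsHUDG.discGraph_comap {V W : Type*} (p : V → UpperHalfPlane) {r : ℝ} (hr : 0 < r)
    (e : W ≃ V) : IsHUDG ((discGraph p r).comap e) :=
  ⟨r, hr, p ∘ e, fun _ _ => and_congr_left' e.injective.ne_iff⟩

/-- The graphs of the construction have unbounded row-treewidth. -/
theorem lt_rowTreewidth_of_iso_levelGraph {V : Type*} [Finite V] {G : SimpleGraph V} {c : ℕ}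
    (e : G ≃g levelGraph (3 * (c + 1) + 1)) : c < rowTreewidth G := by
  by_contra! hc
  obtain ⟨m, l, H, hH, hG⟩ := exists_isContained_strongProduct G
  obtain ⟨t, D, hD⟩ := exists_treeDecomposition_card_le H
  have := card_le_of_isContained_strongProduct hG D (k := c + 1)
    (fun i => (hD i).trans (by omega)) (e.symm none) (fun i => levelSize i)
    (fun i => levelSize_pos i) (fun i u => e.symm (some ⟨i, u⟩))
    (fun i j u v h => congrArg Sigma.fst (Option.some_injective _ (e.symm.injective h)))
    (fun i u => e.symm.map_adj_iff.2 (levelGraph_adj_none _ _))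
    (fun i u h => e.symm.map_adj_iff.2 (levelGraph_adj_succ i u h))
    (fun i j h => by
      obtain ⟨u, v, huv⟩ := exists_levelGraph_adj h
      exact ⟨u, v, e.symm.map_adj_iff.2 huv⟩)
  omega

end RowTw

theorem theorem1 : ¬ RowTw.HasProductStructure (RowTw.hudgClass 5) := by
  rintro ⟨c, hc⟩
  obtain ⟨n, ⟨e⟩⟩ := Finite.exists_equiv_fin (RowTw.Vertex (3 * (c + 1) + 1))
  let G := (RowTw.levelGraph (3 * (c + 1) + 1)).comap e.symm
  have iso : G ≃g RowTw.levelGraph (3 * (c + 1) + 1) := SimpleGraph.Iso.comap e.symm _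
  refine (hc n G ⟨?_, ?_⟩).not_gt (RowTw.lt_rowTreewidth_of_iso_levelGraph iso)
  · refine RowTw.IsHUDG.discGraph_comap _ (Real.arsinh_pos_iff.2 ?_) _
    have := RowTw.scale_pos (3 * (c + 1) + 1)
    positivity
  · by_contra! h
    obtain ⟨s, hs⟩ := G.exists_isNClique_cliqueNum
    exact ((RowTw.levelGraph_cliqueFree _).comap iso.toEmbedding.isContained).mono h s hs
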